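/- For $T\ge 3$ let $\tau$ be uniformly distributed in $[T,2T]$, and for real $k,h$ let \[ S_k(h)=\sum_{\substack{p\ \mathrm{prime}\\ \log p\le e^{k}}}\operatorname{Re}\Big(\frac{1}{p^{1/2+i(\tau+h)}}+\frac12\,\frac{1}{p^{1+2i(\tau+h)}}\Big). \] For $\theta\in(-1,0]$ put $t_\theta=|\theta|\log\log T$. Then there exist absolute constants $c,C>0$ (independent of $\theta$, $x$ and $T$) such that for every $\theta\in(-1,0]$, every $x>0$ and every $T\ge 3$ with $(\log T)^{1+\theta}\ge x^2$ (so, given $\theta$ and $x$, for all sufficiently large $T$), \[ \mathbb{P}\Big(\max_{|h|\le (\log T)^{\theta}}\big|S_{t_\theta}(h)-S_{t_\theta}(0)\big|>x\Big)\le C e^{-x^2/c}. \] -/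

import Mathlib

noncomputable section

/-- The finite set of primes `p` with `log p ≤ e ^ k`, that is `p ≤ exp (e ^ k)`
(see `mem_primesLogLe`). -/
def primesLogLe (k : ℝ) : Finset ℕ :=
  (Finset.range (⌊Real.exp (Real.exp k)⌋₊ + 1)).filter Nat.Prime

theorem mem_primesLogLe (k : ℝ) (p : ℕ) :
    p ∈ primesLogLe k ↔ p.Prime ∧ Real.log p ≤ Real.exp k := by
  rw [primesLogLe, Finset.mem_filter, Finset.mem_range, Nat.lt_succ_iff,
    Nat.le_floor_iff (Real.exp_pos _).le, and_comm]
  refine and_congr_right fun hp => ?_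
  rw [Real.log_le_iff_le_exp (by exact_mod_cast hp.pos)]

/-- The Dirichlet sum
`S_k(h) = ∑_{log p ≤ e^k} Re (p ^ (-(1/2 + i(τ+h))) + (1/2) p ^ (-(1 + 2i(τ+h))))`
at the sample point `τ`. -/
def primeSum (k τ h : ℝ) : ℝ :=
  ∑ p ∈ primesLogLe k,
    (1 / (p : ℂ) ^ (1 / 2 + Complex.I * (τ + h) : ℂ)
      + 1 / 2 * (1 / (p : ℂ) ^ (1 + 2 * Complex.I * (τ + h) : ℂ))).re

/-- `t_θ = |θ| log log T`. -/
def tTheta (θ T : ℝ) : ℝ := |θ| * Real.log (Real.log T)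

/-- The values `|S_{t_θ}(h) - S_{t_θ}(0)|` for `|h| ≤ (log T) ^ θ`. -/
def deviations (θ T τ : ℝ) : Set ℝ :=
  (fun h : ℝ => |primeSum (tTheta θ T) τ h - primeSum (tTheta θ T) τ 0|) ''
    {h : ℝ | |h| ≤ Real.log T ^ θ}

/-- `max_{|h| ≤ (log T)^θ} |S_{t_θ}(h) - S_{t_θ}(0)|`; the maximum is attained for `T ≥ 1`
(see `isGreatest_maxDeviation`). -/
def maxDeviation (θ T τ : ℝ) : ℝ := sSup (deviations θ T τ)

theorem continuous_primeSum (k τ : ℝ) : Continuous (primeSum k τ) := by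
  unfold primeSum
  refine continuous_finsetSum _ fun p hp => Complex.continuous_re.comp ?_
  have hp0 : (p : ℂ) ≠ 0 := by
    exact_mod_cast ((mem_primesLogLe k p).1 hp).1.ne_zero
  refine Continuous.add ?_ (continuous_const.mul ?_)
  · refine continuous_const.div ?_ fun h => by simp [Complex.cpow_eq_zero_iff, hp0]
    exact Continuous.const_cpow (by fun_prop) (Or.inl hp0)
  · refine continuous_const.div ?_ fun h => by simp [Complex.cpow_eq_zero_iff, hp0]
    exact Continuous.const_cpow (by fun_prop) (Or.inl hp0)

theorem isGreatest_maxDeviation (θ T τ : ℝ) (hT : 1 ≤ T) :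
    IsGreatest (deviations θ T τ) (maxDeviation θ T τ) := by
  have hset : {h : ℝ | |h| ≤ Real.log T ^ θ} = Set.Icc (-(Real.log T ^ θ)) (Real.log T ^ θ) := by
    ext h
    simp [abs_le]
  have hc : IsCompact (deviations θ T τ) := by
    unfold deviations
    rw [hset]
    exact isCompact_Icc.image (((continuous_primeSum _ τ).sub continuous_const).abs)
  refine hc.isGreatest_sSup (Set.Nonempty.image _ ⟨0, ?_⟩)
  simpa using Real.rpow_nonneg (Real.log_nonneg hT) θ

/-- The law of a random variable uniformly distributed in `[T, 2T]`. -/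
def uniformLaw (T : ℝ) : MeasureTheory.Measure ℝ :=
  ProbabilityTheory.cond MeasureTheory.volume (Set.Icc T (2 * T))

theorem isProbabilityMeasure_uniformLaw (T : ℝ) (hT : 0 < T) :
    MeasureTheory.IsProbabilityMeasure (uniformLaw T) := by
  apply ProbabilityTheory.cond_isProbabilityMeasure_of_finite <;>
    simp [Real.volume_Icc] <;> linarith

end

open MeasureTheory

theorem sum_primes_log_div_le (n : ℕ) :
    ∑ p ∈ (Finset.range (n + 1)).filter Nat.Prime, Real.log p / p ≤ 2 * Real.log n := by
  rcases Nat.eq_zero_or_pos n with rfl | hn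
  · simp [Finset.sum_filter]
  have hdvd : ∏ p ∈ (Finset.range (n + 1)).filter Nat.Prime, p ^ (n / p) ∣ n.factorial := by
    refine Finset.prod_dvd_of_isRelPrime (fun a ha b hb hab => ?_) fun p hp => ?_
    · have ha' := (Finset.mem_filter.1 ha).2
      have hb' := (Finset.mem_filter.1 hb).2
      exact Nat.coprime_iff_isRelPrime.1 (Nat.Coprime.pow _ _ ((Nat.coprime_primes ha' hb').2 hab))
    · have hp' := (Finset.mem_filter.1 hp).2
      rw [hp'.pow_dvd_factorial_iff (b := Nat.log p n + 2) (by omega)]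
      have := Finset.single_le_sum (f := fun i => n / p ^ i) (s := Finset.Ico 1 (Nat.log p n + 2))
        (fun _ _ => Nat.zero_le _) (a := 1) (by simp)
      simpa using this
  have hle : ∏ p ∈ (Finset.range (n + 1)).filter Nat.Prime, p ^ (n / p) ≤ n ^ n :=
    (Nat.le_of_dvd n.factorial_pos hdvd).trans n.factorial_le_pow
  have hlog : ∑ p ∈ (Finset.range (n + 1)).filter Nat.Prime, ((n / p : ℕ) : ℝ) * Real.log p
      ≤ n * Real.log n := by
    have h1 : Real.log ((∏ p ∈ (Finset.range (n + 1)).filter Nat.Prime, p ^ (n / p) : ℕ) : ℝ)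
        ≤ Real.log ((n ^ n : ℕ) : ℝ) := by
      refine Real.log_le_log ?_ (by exact_mod_cast hle)
      exact_mod_cast Finset.prod_pos fun p hp => pow_pos (Nat.Prime.pos (Finset.mem_filter.1 hp).2) _
    rw [Nat.cast_prod, Real.log_prod] at h1
    · simpa using h1
    · intro p hp
      have := (Finset.mem_filter.1 hp).2.ne_zero
      positivity
  have hn' : (0 : ℝ) < n := by exact_mod_cast hn
  have hterm : ∀ p ∈ (Finset.range (n + 1)).filter Nat.Prime,
      n * (Real.log p / p) ≤ 2 * (((n / p : ℕ) : ℝ) * Real.log p) := by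
    intro p hp
    obtain ⟨hr, hp'⟩ := Finset.mem_filter.1 hp
    have hpn : p ≤ n := Nat.lt_succ_iff.1 (Finset.mem_range.1 hr)
    have hp0 : (0 : ℝ) < p := by exact_mod_cast hp'.pos
    have h2 : n ≤ 2 * (n / p) * p := by
      have h3 := Nat.div_add_mod n p
      have h4 := Nat.mod_lt n hp'.pos
      have h5 : 1 ≤ n / p := Nat.div_pos hpn hp'.pos
      nlinarith
    have h2' : (n : ℝ) ≤ 2 * ((n / p : ℕ) : ℝ) * p := by exact_mod_cast h2
    have hl : 0 ≤ Real.log p := Real.log_natCast_nonneg p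
    have h6 : (n : ℝ) / p ≤ 2 * ((n / p : ℕ) : ℝ) := (div_le_iff₀ hp0).2 h2'
    calc n * (Real.log p / p) = n / p * Real.log p := by ring
      _ ≤ 2 * ((n / p : ℕ) : ℝ) * Real.log p := by gcongr
      _ = _ := by ring
  have hsum := Finset.sum_le_sum hterm
  rw [← Finset.mul_sum, ← Finset.mul_sum] at hsum
  have : n * ∑ p ∈ (Finset.range (n + 1)).filter Nat.Prime, Real.log p / p
      ≤ n * (2 * Real.log n) := by linarith
  exact le_of_mul_le_mul_left this hn'

theorem sum_primesLogLe_log_div_le (k : ℝ) :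
    ∑ p ∈ primesLogLe k, Real.log p / p ≤ 2 * Real.exp k := by
  refine (sum_primes_log_div_le _).trans ?_
  have h1 : (0 : ℝ) < (⌊Real.exp (Real.exp k)⌋₊ : ℝ) := by
    exact_mod_cast Nat.floor_pos.2 (Real.one_le_exp (Real.exp_pos k).le)
  have h2 := Real.log_le_log h1 (Nat.floor_le (Real.exp_pos (Real.exp k)).le)
  rw [Real.log_exp] at h2
  linarith

theorem card_primesLogLe_le (k : ℝ) : ((primesLogLe k).card : ℝ) ≤ Real.exp (Real.exp k) := by
  have h : primesLogLe k ⊆ Finset.Icc 1 ⌊Real.exp (Real.exp k)⌋₊ := by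
    intro p hp
    have h1 := Finset.mem_filter.1 hp
    have h2 := Finset.mem_range.1 h1.1
    exact Finset.mem_Icc.2 ⟨h1.2.one_le, by omega⟩
  have h2 := Finset.card_le_card h
  rw [Nat.card_Icc, Nat.add_sub_cancel] at h2
  exact (Nat.cast_le.2 h2).trans (Nat.floor_le (Real.exp_pos _).le)

theorem one_div_le_abs_log_sub_log {m n : ℕ} {M : ℝ} (hm : 0 < m) (hn : 0 < n) (hmn : m ≠ n)
    (hmM : (m : ℝ) ≤ M) (hnM : (n : ℝ) ≤ M) :
    1 / M ≤ |Real.log m - Real.log n| := by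
  wlog h : n < m generalizing m n
  · rw [abs_sub_comm]
    exact this hn hm hmn.symm hnM hmM (by omega)
  have hm' : (0 : ℝ) < m := by exact_mod_cast hm
  have hn' : (0 : ℝ) < n := by exact_mod_cast hn
  rw [← Real.log_div hm'.ne' hn'.ne']
  refine le_trans ?_ (le_abs_self _)
  have h1 := Real.one_sub_inv_le_log_of_pos (div_pos hm' hn')
  rw [inv_div] at h1
  have h2 : (n : ℝ) + 1 ≤ m := by exact_mod_cast h
  have h3 : 1 / M ≤ 1 / (m : ℝ) := one_div_le_one_div_of_le hm' hmM
  have h4 : 1 / (m : ℝ) ≤ 1 - n / m := by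
    rw [one_sub_div hm'.ne']
    gcongr
    linarith
  linarith

theorem abs_integral_cos_mul_le {c : ℝ} (hc : c ≠ 0) (a b : ℝ) :
    |∫ t in a..b, Real.cos (t * c)| ≤ 2 / |c| := by
  rw [intervalIntegral.integral_comp_mul_right _ hc, integral_cos, smul_eq_mul, abs_mul, abs_inv,
    div_eq_inv_mul]
  gcongr
  rw [abs_le]
  constructor <;> linarith [Real.neg_one_le_sin (b * c), Real.sin_le_one (b * c),
    Real.neg_one_le_sin (a * c), Real.sin_le_one (a * c)]

/-- The exponential polynomial `∑ i ∈ F, B i * exp (- I * t * log (ν i))`. -/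
noncomputable def dirichletPoly {ι : Type*} (F : Finset ι) (B : ι → ℝ) (ν : ι → ℕ) (t : ℝ) : ℂ :=
  ∑ i ∈ F, (B i : ℂ) * Complex.exp (((-(t * Real.log (ν i)) : ℝ) : ℂ) * Complex.I)

@[fun_prop]
theorem continuous_dirichletPoly {ι : Type*} (F : Finset ι) (B : ι → ℝ) (ν : ι → ℕ) :
    Continuous (dirichletPoly F B ν) := by
  unfold dirichletPoly
  fun_prop

theorem norm_sq_dirichletPoly {ι : Type*} (F : Finset ι) (B : ι → ℝ) (ν : ι → ℕ) (t : ℝ) :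
    ‖dirichletPoly F B ν t‖ ^ 2 =
      ∑ i ∈ F, ∑ j ∈ F, B i * B j * Real.cos (t * (Real.log (ν i) - Real.log (ν j))) := by
  rw [← Complex.normSq_eq_norm_sq, Complex.normSq_apply, dirichletPoly, Complex.re_sum,
    Complex.im_sum, Finset.sum_mul_sum, Finset.sum_mul_sum, ← Finset.sum_add_distrib]
  refine Finset.sum_congr rfl fun i _ => ?_
  rw [← Finset.sum_add_distrib]
  refine Finset.sum_congr rfl fun j _ => ?_
  rw [Complex.re_ofReal_mul, Complex.re_ofReal_mul, Complex.im_ofReal_mul, Complex.im_ofReal_mul,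
    Complex.exp_ofReal_mul_I_re, Complex.exp_ofReal_mul_I_re, Complex.exp_ofReal_mul_I_im,
    Complex.exp_ofReal_mul_I_im, Real.cos_neg, Real.cos_neg, Real.sin_neg, Real.sin_neg,
    mul_sub, Real.cos_sub]
  ring

/-- A mean value estimate for Dirichlet polynomials of length `M`. -/
theorem integral_norm_sq_dirichletPoly_le {ι : Type*} (F : Finset ι) (B : ι → ℝ) (ν : ι → ℕ)
    (hB : ∀ i ∈ F, 0 ≤ B i) {M : ℝ} (hν : ∀ i ∈ F, 0 < ν i) (hM : ∀ i ∈ F, (ν i : ℝ) ≤ M) (a b : ℝ) :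
    ∫ t in a..b, ‖dirichletPoly F B ν t‖ ^ 2 ≤
      (b - a) * ∑ i ∈ F, ∑ j ∈ F with ν j = ν i, B i * B j + 2 * M * (∑ i ∈ F, B i) ^ 2 := by
  simp_rw [norm_sq_dirichletPoly]
  rw [intervalIntegral.integral_finsetSum fun i _ => Continuous.intervalIntegrable
    (by fun_prop) _ _, sq, Finset.sum_mul_sum, Finset.mul_sum, Finset.mul_sum,
    ← Finset.sum_add_distrib]
  refine Finset.sum_le_sum fun i hi => ?_
  rw [intervalIntegral.integral_finsetSum fun i _ => Continuous.intervalIntegrable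
    (by fun_prop) _ _, Finset.sum_filter, Finset.mul_sum, Finset.mul_sum, ← Finset.sum_add_distrib]
  refine Finset.sum_le_sum fun j hj => ?_
  have hBB : 0 ≤ B i * B j := mul_nonneg (hB i hi) (hB j hj)
  have hM0 : 0 < M := lt_of_lt_of_le (by exact_mod_cast hν i hi) (hM i hi)
  rw [intervalIntegral.integral_const_mul]
  split_ifs with h
  · simp only [h, sub_self, mul_zero, Real.cos_zero, intervalIntegral.integral_const, smul_eq_mul,
      mul_one]
    nlinarith [mul_nonneg hM0.le hBB]
  · have h1 := one_div_le_abs_log_sub_log (hν i hi) (hν j hj) (Ne.symm h) (hM i hi) (hM j hj)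
    have h0 : (0 : ℝ) < 1 / M := by positivity
    have hc : Real.log (ν i) - Real.log (ν j) ≠ 0 := abs_pos.1 (h0.trans_le h1)
    have h2 := (le_abs_self _).trans (abs_integral_cos_mul_le hc a b)
    have h3 : 2 / |Real.log (ν i) - Real.log (ν j)| ≤ 2 * M := by
      rw [div_le_iff₀ (abs_pos.2 hc)]
      have := mul_le_mul_of_nonneg_left h1 hM0.le
      rw [mul_one_div_cancel hM0.ne'] at this
      linarith
    have := mul_le_mul_of_nonneg_left (h2.trans h3) hBB
    linarith

theorem perm_ofFn_of_prod_eq {q : ℕ} {f g : Fin q → ℕ} (hf : ∀ i, (f i).Prime)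
    (hg : ∀ i, (g i).Prime) (h : ∏ i, f i = ∏ i, g i) : (List.ofFn f).Perm (List.ofFn g) := by
  have h1 : (List.ofFn f).Perm (∏ i, f i).primeFactorsList :=
    Nat.primeFactorsList_unique (List.prod_ofFn) (by simpa [List.mem_ofFn] using hf)
  have h2 : (List.ofFn g).Perm (∏ i, g i).primeFactorsList :=
    Nat.primeFactorsList_unique (List.prod_ofFn) (by simpa [List.mem_ofFn] using hg)
  rw [h] at h1
  exact h1.trans h2.symm

theorem card_filter_prod_eq_le {s : Finset ℕ} (hs : ∀ p ∈ s, p.Prime) {q : ℕ} {f : Fin q → ℕ}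
    (hf : ∀ i, (f i).Prime) :
    {g ∈ Fintype.piFinset fun _ : Fin q => s | ∏ i, g i = ∏ i, f i}.card ≤ q.factorial := by
  have h1 : (Finset.image List.ofFn
      {g ∈ Fintype.piFinset fun _ : Fin q => s | ∏ i, g i = ∏ i, f i}) ⊆
      (List.ofFn f).permutations.toFinset := by
    intro l hl
    obtain ⟨g, hg, rfl⟩ := Finset.mem_image.1 hl
    obtain ⟨hgs, hgf⟩ := Finset.mem_filter.1 hg
    rw [List.mem_toFinset, List.mem_permutations]
    exact perm_ofFn_of_prod_eq (fun i => hs _ (Fintype.mem_piFinset.1 hgs i)) hf hgf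
  have h2 := Finset.card_le_card h1
  rw [Finset.card_image_of_injective _ List.ofFn_injective] at h2
  refine h2.trans ((List.toFinset_card_le _).trans ?_)
  rw [List.length_permutations, List.length_ofFn]

theorem dirichletPoly_pow (s : Finset ℕ) (b : ℕ → ℝ) (hs : ∀ p ∈ s, p ≠ 0) (q : ℕ) (t : ℝ) :
    dirichletPoly s b id t ^ q =
      dirichletPoly (Fintype.piFinset fun _ : Fin q => s) (fun f => ∏ i, b (f i))
        (fun f => ∏ i, f i) t := by
  rw [dirichletPoly, Finset.sum_pow', dirichletPoly]
  refine Finset.sum_congr rfl fun f hf => ?_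
  rw [Finset.prod_mul_distrib, ← Complex.exp_sum, ← Finset.sum_mul, Complex.ofReal_prod,
    Nat.cast_prod, Real.log_prod, Finset.mul_sum, ← Finset.sum_neg_distrib, Complex.ofReal_sum]
  · rfl
  · intro i _
    exact_mod_cast hs _ (Fintype.mem_piFinset.1 hf i)

/-- High moments of Dirichlet polynomials supported on primes are at most of Gaussian size. -/
theorem integral_norm_pow_dirichletPoly_le (s : Finset ℕ) (hs : ∀ p ∈ s, p.Prime) (b : ℕ → ℝ)
    (hb : ∀ p, 0 ≤ b p) {N : ℝ} (hN : ∀ p ∈ s, (p : ℝ) ≤ N) (hcard : (s.card : ℝ) ≤ N) (q : ℕ)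
    {a a' : ℝ} (haa : a ≤ a') :
    ∫ t in a..a', ‖dirichletPoly s b id t‖ ^ (2 * q) ≤
      ((a' - a) * q.factorial + 2 * (N ^ q * N ^ q)) * (∑ p ∈ s, b p ^ 2) ^ q := by
  have hN0 : 0 ≤ N := (Nat.cast_nonneg _).trans hcard
  have hprime : ∀ f ∈ Fintype.piFinset fun _ : Fin q => s, ∀ i, (f i).Prime := fun f hf i =>
    hs _ (Fintype.mem_piFinset.1 hf i)
  have hmv := integral_norm_sq_dirichletPoly_le (Fintype.piFinset fun _ : Fin q => s)
    (fun f => ∏ i, b (f i)) (fun f => ∏ i, f i) (fun f _ => Finset.prod_nonneg fun i _ => hb _)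
    (M := N ^ q) (fun f hf => Finset.prod_pos fun i _ => (hprime f hf i).pos)
    (fun f hf => by
      rw [Nat.cast_prod]
      refine (Finset.prod_le_prod (fun i _ => Nat.cast_nonneg _)
        fun i _ => hN _ (Fintype.mem_piFinset.1 hf i)).trans ?_
      simp) a a'
  have hpow : ∀ t, ‖dirichletPoly s b id t‖ ^ (2 * q) =
      ‖dirichletPoly (Fintype.piFinset fun _ : Fin q => s) (fun f => ∏ i, b (f i))
        (fun f => ∏ i, f i) t‖ ^ 2 := fun t => by
    rw [← dirichletPoly_pow s b (fun p hp => (hs p hp).ne_zero), norm_pow, ← pow_mul, mul_comm]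
  simp_rw [hpow]
  refine hmv.trans ?_
  have hV : ∑ f ∈ Fintype.piFinset fun _ : Fin q => s, (∏ i, b (f i)) ^ 2
      = (∑ p ∈ s, b p ^ 2) ^ q := by
    rw [Finset.sum_pow']
    exact Finset.sum_congr rfl fun f _ => (Finset.prod_pow _ _ _).symm
  have hdiag : ∑ f ∈ Fintype.piFinset fun _ : Fin q => s,
      ∑ g ∈ Fintype.piFinset fun _ : Fin q => s with ∏ i, g i = ∏ i, f i,
        (∏ i, b (f i)) * ∏ i, b (g i) ≤ q.factorial * (∑ p ∈ s, b p ^ 2) ^ q := by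
    rw [← hV, Finset.mul_sum]
    refine Finset.sum_le_sum fun f hf => ?_
    have heq : ∀ g ∈ {g ∈ Fintype.piFinset fun _ : Fin q => s | ∏ i, g i = ∏ i, f i},
        (∏ i, b (f i)) * ∏ i, b (g i) = (∏ i, b (f i)) ^ 2 := by
      intro g hg
      obtain ⟨hgs, hgf⟩ := Finset.mem_filter.1 hg
      have hp := ((perm_ofFn_of_prod_eq (hprime g hgs) (hprime f hf) hgf).map b).prod_eq
      rw [List.map_ofFn, List.map_ofFn, List.prod_ofFn, List.prod_ofFn] at hp
      simp only [Function.comp_apply] at hp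
      rw [hp, sq]
    rw [Finset.sum_congr rfl heq, Finset.sum_const, nsmul_eq_mul]
    gcongr
    exact card_filter_prod_eq_le hs (hprime f hf)
  have hoff : (∑ f ∈ Fintype.piFinset fun _ : Fin q => s, ∏ i, b (f i)) ^ 2
      ≤ N ^ q * (∑ p ∈ s, b p ^ 2) ^ q := by
    rw [← Finset.sum_pow', ← pow_mul, mul_comm, pow_mul, ← mul_pow]
    gcongr
    exact sq_sum_le_card_mul_sum_sq.trans (by gcongr)
  have h1 := mul_le_mul_of_nonneg_left hdiag (sub_nonneg.2 haa)
  have h2 := mul_le_mul_of_nonneg_left hoff (a := 2 * N ^ q) (by positivity)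
  linarith

theorem pow_integral_le {g : ℝ → ℝ} (hg : Continuous g) (hg0 : ∀ u, 0 ≤ g u) {a : ℝ} (ha : 0 < a)
    (n : ℕ) :
    (∫ u in (-a)..a, g u) ^ n ≤ (2 * a) ^ n / (2 * a) * ∫ u in (-a)..a, g u ^ n := by
  have h := (convexOn_pow n).map_set_average_le (μ := volume) (t := Set.Ioc (-a) a) (f := g)
    (continuous_pow n).continuousOn isClosed_Ici (by simp [Real.volume_Ioc]; linarith)
    (by simp [Real.volume_Ioc]) (Filter.Eventually.of_forall hg0)
    ((hg.continuousOn.integrableOn_Icc).mono_set Set.Ioc_subset_Icc_self)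
    (((hg.pow n).continuousOn.integrableOn_Icc).mono_set Set.Ioc_subset_Icc_self)
  have hvol : volume.real (Set.Ioc (-a) a) = 2 * a := by
    rw [Measure.real, Real.volume_Ioc, ENNReal.toReal_ofReal (by linarith)]
    ring
  rw [setAverage_eq, setAverage_eq, hvol, smul_eq_mul, smul_eq_mul, mul_pow,
    ← intervalIntegral.integral_of_le (by linarith), ← intervalIntegral.integral_of_le (by linarith)]
    at h
  have h2a : (0 : ℝ) < (2 * a) ^ n := by positivity
  have h' := mul_le_mul_of_nonneg_left h h2a.le
  rw [← mul_assoc, ← mul_pow, mul_inv_cancel₀ (by positivity), one_pow, one_mul, ← mul_assoc,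
    ← div_eq_mul_inv] at h'
  exact h'

theorem one_div_cpow_re {p : ℕ} (hp : p ≠ 0) (σ t : ℝ) :
    (1 / (p : ℂ) ^ ((σ : ℂ) + Complex.I * t)).re = Real.cos (t * Real.log p) / (p : ℝ) ^ σ := by
  have hp0 : (p : ℂ) ≠ 0 := by exact_mod_cast hp
  have hpp : (0 : ℝ) < p := by exact_mod_cast Nat.pos_of_ne_zero hp
  have hexp : -((σ : ℂ) + Complex.I * t) = ((-σ : ℝ) : ℂ) + ((-t : ℝ) : ℂ) * Complex.I := by
    push_cast
    ring
  have h2 : (p : ℂ) ^ (((-t : ℝ) : ℂ) * Complex.I)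
      = Complex.exp (((-(t * Real.log p) : ℝ) : ℂ) * Complex.I) := by
    rw [Complex.cpow_def_of_ne_zero hp0, ← Complex.natCast_log]
    push_cast
    ring_nf
  have h3 : (p : ℂ) ^ ((-σ : ℝ) : ℂ) = (((p : ℝ) ^ (-σ) : ℝ) : ℂ) := by
    rw [Complex.ofReal_cpow hpp.le, Complex.ofReal_natCast]
  rw [one_div, ← Complex.cpow_neg, hexp, Complex.cpow_add _ _ hp0, h2, h3, Complex.re_ofReal_mul,
    Complex.exp_ofReal_mul_I_re, Real.cos_neg, Real.rpow_neg hpp.le]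
  ring

theorem primeSum_eq (k τ h : ℝ) :
    primeSum k τ h = ∑ p ∈ primesLogLe k, Real.cos ((τ + h) * Real.log p) / √(p : ℝ) +
      ∑ p ∈ primesLogLe k, 1 / 2 * (Real.cos (2 * (τ + h) * Real.log p) / p) := by
  rw [primeSum, ← Finset.sum_add_distrib]
  refine Finset.sum_congr rfl fun p hp => ?_
  have hp0 := ((mem_primesLogLe k p).1 hp).1.ne_zero
  have h1 := one_div_cpow_re hp0 (1 / 2) (τ + h)
  have h2 := one_div_cpow_re hp0 1 (2 * (τ + h))
  rw [← Real.sqrt_eq_rpow] at h1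
  rw [Real.rpow_one] at h2
  have h12 : ((1 / 2 : ℂ)) = ((1 / 2 : ℝ) : ℂ) := by push_cast; rfl
  rw [Complex.add_re, ← h1, ← h2]
  congr 1
  · push_cast
    rfl
  · rw [h12, Complex.re_ofReal_mul]
    push_cast
    rw [mul_left_comm Complex.I, mul_assoc]

/-- The derivative of the prime part of `primeSum` is the imaginary part of this polynomial. -/
noncomputable def derivPoly (k : ℝ) : ℝ → ℂ :=
  dirichletPoly (primesLogLe k) (fun p => Real.log p / √(p : ℝ)) id

@[fun_prop]
theorem continuous_derivPoly (k : ℝ) : Continuous (derivPoly k) :=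
  continuous_dirichletPoly _ _ _

theorem hasDerivAt_sum_cos_div_sqrt (k τ h : ℝ) :
    HasDerivAt (fun h => ∑ p ∈ primesLogLe k, Real.cos ((τ + h) * Real.log p) / √(p : ℝ))
      (derivPoly k (τ + h)).im h := by
  have : (derivPoly k (τ + h)).im = ∑ p ∈ primesLogLe k,
      -Real.sin ((τ + h) * Real.log p) * (1 * Real.log p) / √(p : ℝ) := by
    rw [derivPoly, dirichletPoly, Complex.im_sum]
    refine Finset.sum_congr rfl fun p _ => ?_
    rw [Complex.im_ofReal_mul, Complex.exp_ofReal_mul_I_im, Real.sin_neg, id]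
    ring
  rw [this]
  refine HasDerivAt.fun_sum fun p _ => HasDerivAt.div_const (HasDerivAt.cos ?_) _
  exact ((hasDerivAt_id h).const_add τ).mul_const _

theorem abs_sum_cos_div_sub_le (k τ h : ℝ) :
    |∑ p ∈ primesLogLe k, 1 / 2 * (Real.cos (2 * (τ + h) * Real.log p) / p) -
      ∑ p ∈ primesLogLe k, 1 / 2 * (Real.cos (2 * (τ + 0) * Real.log p) / p)| ≤
      |h| * (2 * Real.exp k) := by
  rw [← Finset.sum_sub_distrib]
  refine (Finset.abs_sum_le_sum_abs _ _).trans ?_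
  refine le_trans (Finset.sum_le_sum (g := fun p : ℕ => |h| * (Real.log p / p)) fun p _ => ?_) ?_
  · have h1 := Real.abs_cos_sub_cos_le (2 * (τ + h) * Real.log p) (2 * (τ + 0) * Real.log p)
    have h2 : 2 * (τ + h) * Real.log p - 2 * (τ + 0) * Real.log p = 2 * Real.log p * h := by ring
    rw [h2, abs_mul, abs_of_nonneg (mul_nonneg zero_le_two (Real.log_natCast_nonneg p))] at h1
    rw [← mul_sub, ← sub_div, abs_mul, abs_div _ (p : ℝ), Nat.abs_cast,
      abs_of_pos (one_half_pos (α := ℝ))]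
    calc 1 / 2 * (|Real.cos (2 * (τ + h) * Real.log p) - Real.cos (2 * (τ + 0) * Real.log p)| / p)
        ≤ 1 / 2 * (2 * Real.log p * |h| / p) := by gcongr
      _ = |h| * (Real.log p / p) := by ring
  · rw [← Finset.mul_sum]
    exact mul_le_mul_of_nonneg_left (sum_primesLogLe_log_div_le k) (abs_nonneg h)

theorem abs_primeSum_sub_le {k τ h a : ℝ} (hh : |h| ≤ a) :
    |primeSum k τ h - primeSum k τ 0| ≤
      (∫ u in (-a)..a, ‖derivPoly k (τ + u)‖) + a * (2 * Real.exp k) := by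
  have hcont : Continuous fun u => ‖derivPoly k (τ + u)‖ := by fun_prop
  have hftc := intervalIntegral.integral_eq_sub_of_hasDerivAt (a := 0) (b := h)
    (fun u _ => hasDerivAt_sum_cos_div_sqrt k τ u) (Continuous.intervalIntegrable
      (Complex.continuous_im.comp (by fun_prop)) _ _)
  have hsub : Set.uIoc 0 h ⊆ Set.Ioc (-a) a := by
    rw [abs_le] at hh
    refine fun u hu => ?_
    rcases Set.mem_uIoc.1 hu with hu | hu
    · exact ⟨by linarith [hu.1], by linarith [hu.2]⟩
    · exact ⟨by linarith [hu.1], by linarith [hu.2]⟩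
  have h1 : |∫ u in (0 : ℝ)..h, (derivPoly k (τ + u)).im| ≤
      ∫ u in (-a)..a, ‖derivPoly k (τ + u)‖ := by
    rw [← Real.norm_eq_abs, intervalIntegral.integral_of_le (a := -a)
      (by linarith [abs_nonneg h])]
    refine intervalIntegral.norm_integral_le_integral_norm_uIoc.trans ?_
    have hint : IntegrableOn (fun u => ‖derivPoly k (τ + u)‖) (Set.Ioc (-a) a) :=
      hcont.continuousOn.integrableOn_Icc.mono_set Set.Ioc_subset_Icc_self
    refine le_trans ?_ (setIntegral_mono_set hint
      (Filter.Eventually.of_forall fun _ => norm_nonneg _) (Filter.Eventually.of_forall hsub))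
    refine integral_mono_of_nonneg (Filter.Eventually.of_forall fun _ => norm_nonneg _)
      (hint.mono_set hsub) (Filter.Eventually.of_forall fun u => ?_)
    exact Complex.abs_im_le_norm _
  have h2 := (abs_sum_cos_div_sub_le k τ h).trans
    (mul_le_mul_of_nonneg_right hh (mul_nonneg zero_le_two (Real.exp_pos k).le))
  rw [hftc] at h1
  rw [primeSum_eq, primeSum_eq, add_sub_add_comm]
  exact (abs_add_le _ _).trans (add_le_add h1 h2)

theorem sum_sq_weights_le (k : ℝ) :
    ∑ p ∈ primesLogLe k, (Real.log p / √(p : ℝ)) ^ 2 ≤ 2 * Real.exp k ^ 2 := by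
  calc ∑ p ∈ primesLogLe k, (Real.log p / √(p : ℝ)) ^ 2
      ≤ ∑ p ∈ primesLogLe k, Real.exp k * (Real.log p / p) := by
        refine Finset.sum_le_sum fun p hp => ?_
        have h1 := ((mem_primesLogLe k p).1 hp).2
        have h0 : 0 ≤ Real.log p := Real.log_natCast_nonneg p
        rw [div_pow, Real.sq_sqrt (Nat.cast_nonneg p), sq, mul_div_assoc]
        gcongr
    _ ≤ Real.exp k * (2 * Real.exp k) := by
        rw [← Finset.mul_sum]
        exact mul_le_mul_of_nonneg_left (sum_primesLogLe_log_div_le k) (Real.exp_pos k).le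
    _ = _ := by ring

theorem integral_norm_pow_derivPoly_le {k T : ℝ} (hT : 0 < T) {q : ℕ}
    (hq : 2 * q * Real.exp k ≤ Real.log T) (u : ℝ) :
    ∫ τ in T..(2 * T), ‖derivPoly k (τ + u)‖ ^ (2 * q) ≤
      T * (3 * q.factorial * (2 * Real.exp k ^ 2) ^ q) := by
  rw [intervalIntegral.integral_comp_add_right (fun t => ‖derivPoly k t‖ ^ (2 * q))]
  have h1 := integral_norm_pow_dirichletPoly_le (primesLogLe k)
    (fun p hp => ((mem_primesLogLe k p).1 hp).1) (fun p => Real.log p / √(p : ℝ))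
    (fun p => div_nonneg (Real.log_natCast_nonneg p) (Real.sqrt_nonneg _))
    (N := Real.exp (Real.exp k))
    (fun p hp => by
      obtain ⟨hp, hl⟩ := (mem_primesLogLe k p).1 hp
      exact (Real.log_le_iff_le_exp (by exact_mod_cast hp.pos)).1 hl)
    (card_primesLogLe_le k) q (a := T + u) (a' := 2 * T + u) (by linarith)
  refine h1.trans ?_
  have hNT : Real.exp (Real.exp k) ^ q * Real.exp (Real.exp k) ^ q ≤ T := by
    rw [← Real.exp_nat_mul, ← Real.exp_add, ← Real.le_log_iff_exp_le hT]
    linarith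
  have hfac : (1 : ℝ) ≤ q.factorial := by exact_mod_cast q.factorial_pos
  have hcoef : (2 * T + u - (T + u)) * q.factorial +
      2 * (Real.exp (Real.exp k) ^ q * Real.exp (Real.exp k) ^ q) ≤ T * (3 * q.factorial) := by
    nlinarith
  have hV := pow_le_pow_left₀ (Finset.sum_nonneg fun _ _ => sq_nonneg _) (sum_sq_weights_le k) q
  refine (mul_le_mul hcoef hV (pow_nonneg (Finset.sum_nonneg fun _ _ => sq_nonneg _) _)
    (by positivity)).trans_eq (by ring)

theorem integral_uniformLaw {T : ℝ} (hT : 0 < T) (f : ℝ → ℝ) :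
    ∫ τ, f τ ∂uniformLaw T = T⁻¹ * ∫ τ in T..(2 * T), f τ := by
  have h : volume (Set.Icc T (2 * T)) = ENNReal.ofReal T := by
    rw [Real.volume_Icc]
    ring_nf
  rw [uniformLaw, ProbabilityTheory.cond, integral_smul_measure, h, ENNReal.toReal_inv,
    ENNReal.toReal_ofReal hT.le, smul_eq_mul, intervalIntegral.integral_of_le (by linarith),
    integral_Icc_eq_integral_Ioc]

theorem integrable_uniformLaw {T : ℝ} (hT : 0 < T) {f : ℝ → ℝ} (hf : Continuous f) :
    Integrable f (uniformLaw T) := by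
  rw [uniformLaw, ProbabilityTheory.cond]
  refine Integrable.smul_measure hf.continuousOn.integrableOn_Icc ?_
  rw [ENNReal.inv_ne_top, Real.volume_Icc]
  simpa using by linarith

theorem uniformLaw_real_lt_integral_le {k T y : ℝ} (hT : 0 < T) (hy : 0 < y) {q : ℕ}
    (hq : 2 * q * Real.exp k ≤ Real.log T) :
    (uniformLaw T).real {τ | y < ∫ u in (-(Real.exp k)⁻¹)..(Real.exp k)⁻¹, ‖derivPoly k (τ + u)‖} ≤
      3 * q.factorial * (8 / y ^ 2) ^ q := by
  have := isProbabilityMeasure_uniformLaw T hT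
  set a := (Real.exp k)⁻¹ with ha_def
  have ha : 0 < a := inv_pos.2 (Real.exp_pos k)
  set G : ℝ → ℝ := fun τ => ∫ u in (-a)..a, ‖derivPoly k (τ + u)‖ ^ (2 * q) with hG
  have hGcont : Continuous G :=
    intervalIntegral.continuous_parametric_intervalIntegral_of_continuous' (by fun_prop) _ _
  have hG0 : ∀ τ, 0 ≤ G τ := fun τ =>
    intervalIntegral.integral_nonneg (by linarith) fun _ _ => by positivity
  have hmean : ∫ τ, G τ ∂uniformLaw T ≤
      2 * a * (3 * q.factorial * (2 * Real.exp k ^ 2) ^ q) := by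
    have hswap : ∫ τ in T..(2 * T), G τ =
        ∫ u in (-a)..a, ∫ τ in T..(2 * T), ‖derivPoly k (τ + u)‖ ^ (2 * q) := by
      refine intervalIntegral_intervalIntegral_swap ?_
      have hc : Continuous (Function.uncurry fun τ u => ‖derivPoly k (τ + u)‖ ^ (2 * q)) := by
        fun_prop
      refine (hc.continuousOn.integrableOn_compact (isCompact_uIcc.prod isCompact_uIcc)).mono_set
        (Set.prod_mono Set.uIoc_subset_uIcc Set.uIoc_subset_uIcc)
    rw [integral_uniformLaw hT, hswap]
    have hmono : ∫ u in (-a)..a, ∫ τ in T..(2 * T), ‖derivPoly k (τ + u)‖ ^ (2 * q) ≤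
        ∫ _ in (-a)..a, T * (3 * q.factorial * (2 * Real.exp k ^ 2) ^ q) := by
      refine intervalIntegral.integral_mono_on (by linarith) (Continuous.intervalIntegrable
        (intervalIntegral.continuous_parametric_intervalIntegral_of_continuous' (by fun_prop) _ _)
        _ _) (by simp) fun u _ => integral_norm_pow_derivPoly_le hT hq u
    rw [intervalIntegral.integral_const, smul_eq_mul] at hmono
    calc T⁻¹ * _ ≤ T⁻¹ * _ := mul_le_mul_of_nonneg_left hmono (inv_pos.2 hT).le
      _ = _ := by
        field_simp
        ring
  have hsub : {τ | y < ∫ u in (-a)..a, ‖derivPoly k (τ + u)‖} ⊆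
      {τ | y ^ (2 * q) * (2 * a) / (2 * a) ^ (2 * q) ≤ G τ} := by
    intro τ hτ
    have h1 := pow_integral_le (g := fun u => ‖derivPoly k (τ + u)‖) (by fun_prop)
      (fun _ => norm_nonneg _) ha (2 * q)
    have h2 := (pow_le_pow_left₀ hy.le (le_of_lt hτ) (2 * q)).trans h1
    rw [Set.mem_ofPred_eq, div_le_iff₀ (by positivity), ← le_div_iff₀ (by positivity)]
    refine h2.trans_eq (by simp only [hG]; ring)
  have hmarkov := mul_meas_ge_le_integral_of_nonneg (μ := uniformLaw T)
    (Filter.Eventually.of_forall hG0) (integrable_uniformLaw hT hGcont)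
    (y ^ (2 * q) * (2 * a) / (2 * a) ^ (2 * q))
  refine (measureReal_mono hsub).trans ?_
  have hε : 0 < y ^ (2 * q) * (2 * a) / (2 * a) ^ (2 * q) := by positivity
  refine le_of_mul_le_mul_left ((hmarkov.trans hmean).trans_eq ?_) hε
  have hak : a ^ (2 * q) * (Real.exp k ^ 2) ^ q = 1 := by
    rw [pow_mul, ← mul_pow, ← mul_pow, ha_def, inv_mul_cancel₀ (Real.exp_pos k).ne', one_pow,
      one_pow]
  rw [eq_comm, div_mul_eq_mul_div, div_eq_iff (by positivity), div_pow, mul_pow 2 a, mul_pow 2,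
    ← pow_mul y 2 q, pow_mul 2 2 q]
  have h8 : (8 : ℝ) ^ q = 2 ^ q * (2 ^ 2) ^ q := by rw [← mul_pow]; norm_num
  rw [h8]
  field_simp
  linear_combination (-1 : ℝ) * hak

theorem exp_tTheta {θ T : ℝ} (hT : 1 < T) : Real.exp (tTheta θ T) = Real.log T ^ |θ| := by
  rw [tTheta, mul_comm, Real.rpow_def_of_pos (Real.log_pos hT)]

theorem maxDeviation_le {θ T τ : ℝ} (hθ : θ ≤ 0) (hT : 1 < T) :
    maxDeviation θ T τ ≤ (∫ u in (-(Real.exp (tTheta θ T))⁻¹)..(Real.exp (tTheta θ T))⁻¹,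
      ‖derivPoly (tTheta θ T) (τ + u)‖) + 2 := by
  obtain ⟨h, hh, heq⟩ := (isGreatest_maxDeviation θ T τ hT.le).1
  rw [← heq]
  have hh' : |h| ≤ (Real.exp (tTheta θ T))⁻¹ := by
    rw [exp_tTheta hT, ← Real.rpow_neg (Real.log_pos hT).le, abs_of_nonpos hθ, neg_neg]
    exact hh
  refine (abs_primeSum_sub_le hh').trans_eq ?_
  rw [mul_left_comm, inv_mul_cancel₀ (Real.exp_pos _).ne', mul_one]

theorem mainTheorem4 :
    ∃ c C : ℝ, 0 < c ∧ 0 < C ∧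
      ∀ θ : ℝ, -1 < θ → θ ≤ 0 →
        ∀ x : ℝ, 0 < x →
          ∀ T : ℝ, 3 ≤ T → x ^ 2 ≤ Real.log T ^ (1 + θ) →
            (uniformLaw T).real {τ : ℝ | x < maxDeviation θ T τ} ≤ C * Real.exp (-x ^ 2 / c) := by
  have he0 := Real.exp_pos 1
  have he1 : (1 : ℝ) ≤ Real.exp 1 := Real.one_le_exp zero_le_one
  refine ⟨32 * Real.exp 1, 3 * Real.exp 1, by positivity, by positivity, ?_⟩
  intro θ _ hθ x hx T hT hxT
  have hT0 : 0 < T := by linarith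
  have hL : 0 < Real.log T := Real.log_pos (by linarith)
  have := isProbabilityMeasure_uniformLaw T hT0
  have hC : 3 * Real.exp 1 * Real.exp (-x ^ 2 / (32 * Real.exp 1)) =
      3 * Real.exp (1 - x ^ 2 / (32 * Real.exp 1)) := by
    rw [mul_assoc, ← Real.exp_add]
    ring_nf
  rw [hC]
  rcases lt_or_ge (x ^ 2) (32 * Real.exp 1) with hsmall | hlarge
  · have h1 : x ^ 2 / (32 * Real.exp 1) ≤ 1 := (div_le_one (by positivity)).2 hsmall.le
    have h2 := Real.one_le_exp (sub_nonneg.2 h1)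
    exact measureReal_le_one.trans (by linarith)
  have hx4 : 4 ≤ x := by nlinarith
  set K := Real.exp (tTheta θ T) with hK
  set q := ⌊x ^ 2 / (32 * Real.exp 1)⌋₊ with hq_def
  have hq : (q : ℝ) ≤ x ^ 2 / (32 * Real.exp 1) := Nat.floor_le (by positivity)
  have hq' : (q : ℝ) * (32 * Real.exp 1) ≤ x ^ 2 := (le_div_iff₀ (by positivity)).1 hq
  have hK0 : 0 < K := Real.exp_pos _
  have hxK : x ^ 2 * K ≤ Real.log T := by
    have h1 : Real.log T ^ (1 + θ) * K = Real.log T := by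
      rw [hK, exp_tTheta (by linarith), ← Real.rpow_add hL, abs_of_nonpos hθ]
      simp
    rw [← h1]
    gcongr
  have hqK : 2 * q * K ≤ Real.log T := by
    refine le_trans ?_ hxK
    gcongr
    nlinarith [Nat.cast_nonneg (α := ℝ) q]
  have htail := uniformLaw_real_lt_integral_le hT0 (half_pos hx) hqK
  have hsub : {τ : ℝ | x < maxDeviation θ T τ} ⊆
      {τ | x / 2 < ∫ u in (-K⁻¹)..K⁻¹, ‖derivPoly (tTheta θ T) (τ + u)‖} := by
    intro τ hτ
    have h1 : x < _ := lt_of_lt_of_le hτ (maxDeviation_le hθ (by linarith))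
    change x / 2 < _
    linarith
  refine (measureReal_mono hsub).trans (htail.trans ?_)
  have hfac : (q.factorial : ℝ) ≤ q ^ q := by exact_mod_cast q.factorial_le_pow
  have hbase : (q : ℝ) * (8 / (x / 2) ^ 2) ≤ Real.exp (-1) := by
    rw [Real.exp_neg, ← one_div, le_div_iff₀ he0]
    calc (q : ℝ) * (8 / (x / 2) ^ 2) * Real.exp 1 = q * (32 * Real.exp 1) / x ^ 2 := by
          field_simp
          ring
      _ ≤ 1 := (div_le_one (by positivity)).2 hq'
  calc 3 * (q.factorial : ℝ) * (8 / (x / 2) ^ 2) ^ q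
      ≤ 3 * (q : ℝ) ^ q * (8 / (x / 2) ^ 2) ^ q := by gcongr
    _ = 3 * ((q : ℝ) * (8 / (x / 2) ^ 2)) ^ q := by rw [mul_pow, mul_assoc]
    _ ≤ 3 * Real.exp (-1) ^ q := by gcongr
    _ = 3 * Real.exp (-q) := by
        rw [← Real.exp_nat_mul]
        ring_nf
    _ ≤ 3 * Real.exp (1 - x ^ 2 / (32 * Real.exp 1)) := by
        gcongr
        have := Nat.lt_floor_add_one (x ^ 2 / (32 * Real.exp 1))
        rw [← hq_def] at this
        linarith
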